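/- For $n\in\mathbb N$ let $\mathcal D_n^1$ be the manifold of strictly positive complex $n\times n$ matrices of trace $1$; its tangent space at every point is the real space of Hermitian $n\times n$ matrices of trace $0$. For a function $f:(0,\infty)\to(0,\infty)$ put $c_f(x,y)=\frac{1}{y\,f(x/y)}$ for $x,y>0$ and $$\langle A,B\rangle_{\rho,f}=\mathrm{Tr}\big(A\,c_f(L_\rho,R_\rho)(B)\big),\qquad L_\rho(B)=\rho B,\quad R_\rho(B)=B\rho,$$ where $\rho\in\mathcal D_n^1$ and $A,B$ are tangent vectors at $\rho$. For $p\in(1,\infty)$ and $\frac1p+\frac1{\tilde p}=1$ let $$f_p(x)=\frac{1}{p\tilde p}\,\frac{(x-1)^2}{(x^{1/p}-1)(x^{1/\tilde p}-1)},\qquad f_1(x)=\frac{x-1}{\log x}\qquad(x>0),$$ with $f_p(1)=f_1(1)=1$ by continuous extension. The Riemannian metric on $\mathcal D_n^1$ given by $f_p$ is the WYD($p$) metric, and the one given by $f_1$ is the BKM metric. Let $\mathrm{Scal}_{f}(\rho)$ be the scalar curvature at $\rho$ of $\mathcal D_n^1$ with the metric $\langle\cdot,\cdot\rangle_{\cdot,f}$.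 For Hermitian matrices $A,B$ write $A\succ B$ ($A$ is more mixed than $B$) if their eigenvalues $a_1\ge\dots\ge a_n$ and $b_1\ge\dots\ge b_n$, listed with multiplicity, satisfy $a_1+\dots+a_k\le b_1+\dots+b_k$ for $1\le k<n$ and $a_1+\dots+a_n=b_1+\dots+b_n$. A function $F:\mathcal D_n^1\to\mathbb R$ is Schur-increasing if $\rho\succ\sigma$ implies $F(\rho)\ge F(\sigma)$ for all $\rho,\sigma\in\mathcal D_n^1$. **Theorem.** Let $n\in\mathbb N$. Suppose that there is an $\varepsilon>0$ such that, for every $p\in(1,1+\varepsilon)$, the scalar curvature $\mathrm{Scal}_{f_p}$ of the WYD($p$) metric is Schur-increasing on $\mathcal D_n^1$. Then the scalar curvature $\mathrm{Scal}_{f_1}$ of the BKM metric is Schur-increasing on $\mathcal D_n^1$; that is, $\rho\succ\sigma$ implies $\mathrm{Scal}_{f_1}(\rho)\ge\mathrm{Scal}_{f_1}(\sigma)$ for all $\rho,\sigma\in\mathcal D_n^1$. -/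

import Mathlib

open scoped Matrix ComplexOrder

noncomputable section

namespace QuantumGeometry

/-! ### Majorization and Schur-increasing functions -/

/-- The decreasing rearrangement of a real vector. -/
def decreasing {n : ℕ} (x : Fin n → ℝ) : Fin n → ℝ :=
  x ∘ Tuple.sort (fun i => -x i)

theorem decreasing_antitone {n : ℕ} (x : Fin n → ℝ) : Antitone (decreasing x) := by
  intro i j hij
  have h := Tuple.monotone_sort (fun i => -x i) hij
  simpa [decreasing] using h

/-- `x` is more mixed than `y`: the sum of the `k` largest components of `x` is at most the sum of
the `k` largest components of `y` for every `k < n`, and the sums of all the components agree. -/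
def MoreMixed {n : ℕ} (x y : Fin n → ℝ) : Prop :=
  (∀ k : ℕ, k < n →
    ∑ i : Fin n with i.val < k, decreasing x i ≤ ∑ i : Fin n with i.val < k, decreasing y i) ∧
  ∑ i, decreasing x i = ∑ i, decreasing y i

/-- A real-valued function is Schur-increasing on a set `𝒜` of Hermitian matrices if `f A ≥ f B`
for all `A`, `B` in `𝒜` such that the vector of eigenvalues of `A` is more mixed than that of
`B`. -/
def SchurIncreasingOn {n : ℕ} (f : Matrix (Fin n) (Fin n) ℂ → ℝ)
    (𝒜 : Set (Matrix (Fin n) (Fin n) ℂ)) : Prop :=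
  ∀ A ∈ 𝒜, ∀ B ∈ 𝒜, ∀ (hA : A.IsHermitian) (hB : B.IsHermitian),
    MoreMixed hA.eigenvalues hB.eigenvalues → f A ≥ f B

/-! ### Density matrices and their tangent space -/

/-- The strictly positive complex `n × n` matrices of trace one. -/
def densityMatrices (n : ℕ) : Set (Matrix (Fin n) (Fin n) ℂ) :=
  {ρ | ρ.PosDef ∧ ρ.trace = 1}

/-- The Hermitian matrices of trace zero: the tangent space of the manifold of density matrices at
every point. The density matrices form a relatively open subset of a translate of it. -/
def tangentSpace (n : ℕ) : Submodule ℝ (Matrix (Fin n) (Fin n) ℂ) where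
  carrier := {A | A.IsHermitian ∧ A.trace = 0}
  add_mem' := by
    rintro A B ⟨hA, hA'⟩ ⟨hB, hB'⟩
    exact ⟨hA.add hB, by simp [hA', hB']⟩
  zero_mem' := ⟨Matrix.isHermitian_zero, by simp⟩
  smul_mem' := by
    rintro c A ⟨hA, hA'⟩
    refine ⟨?_, by simp [hA']⟩
    show (c • A)ᴴ = c • A
    rw [Matrix.conjTranspose_smul, hA.eq, star_trivial]

/-! ### The metric associated with a function `f` -/

/-- The Chentsov–Morozova function `c_f(x, y) = 1 / (y f(x / y))`, for `x, y > 0`. -/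
def chentsovMorozova (f : ℝ → ℝ) (x y : ℝ) : ℝ := 1 / (y * f (x / y))

/-- `c(L_ρ, R_ρ)(B)` for a Hermitian matrix `ρ`, where `L_ρ B = ρ B` and `R_ρ B = B ρ`. If
`ρ = U diag(l₁, …, lₙ) U*` with `U` unitary, then the commuting operators `L_ρ` and `R_ρ` are
jointly diagonalized by the matrices `U Eᵢⱼ U*`, with eigenvalues `lᵢ` and `lⱼ`, so that
`c(L_ρ, R_ρ)` multiplies the `(i, j)` entry of `U* B U` by `c(lᵢ, lⱼ)`. -/
def functionOfLR {n : ℕ} (c : ℝ → ℝ → ℝ) {ρ : Matrix (Fin n) (Fin n) ℂ} (hρ : ρ.IsHermitian)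
    (B : Matrix (Fin n) (Fin n) ℂ) : Matrix (Fin n) (Fin n) ℂ :=
  let U : Matrix (Fin n) (Fin n) ℂ := hρ.eigenvectorUnitary.1
  U * (Matrix.of fun i j =>
    ((c (hρ.eigenvalues i) (hρ.eigenvalues j) : ℝ) : ℂ) * (Uᴴ * B * U) i j) * Uᴴ

/-- `c(L_ρ, R_ρ)` can be computed in any diagonalization `ρ = V diag(d₁, …, dₙ) V*`, so it does not
depend on the choice of eigenvectors. -/
theorem functionOfLR_eq {n : ℕ} (c : ℝ → ℝ → ℝ) {ρ : Matrix (Fin n) (Fin n) ℂ}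
    (hρ : ρ.IsHermitian) (B V : Matrix (Fin n) (Fin n) ℂ) (d : Fin n → ℝ)
    (hV : Vᴴ * V = 1) (hd : ρ = V * Matrix.diagonal (fun i => (d i : ℂ)) * Vᴴ) :
    functionOfLR c hρ B =
      V * (Matrix.of fun i j => ((c (d i) (d j) : ℝ) : ℂ) * (Vᴴ * B * V) i j) * Vᴴ := by
  set U : Matrix (Fin n) (Fin n) ℂ := hρ.eigenvectorUnitary.1
  have hU1 : Uᴴ * U = 1 := (Matrix.mem_unitaryGroup_iff').1 hρ.eigenvectorUnitary.2
  have hU2 : U * Uᴴ = 1 := (Matrix.mem_unitaryGroup_iff).1 hρ.eigenvectorUnitary.2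
  have hV2 : V * Vᴴ = 1 := mul_eq_one_comm.1 hV
  have hρU : ρ = U * Matrix.diagonal (fun i => (hρ.eigenvalues i : ℂ)) * Uᴴ := by
    have h := hρ.spectral_theorem
    rw [Unitary.conjStarAlgAut_apply] at h
    exact h
  set l := hρ.eigenvalues
  obtain ⟨W, hW⟩ : ∃ W : Matrix (Fin n) (Fin n) ℂ, W = Uᴴ * V := ⟨_, rfl⟩
  have hcomm : Matrix.diagonal (fun i => (l i : ℂ)) * W
      = W * Matrix.diagonal (fun i => (d i : ℂ)) := by
    have h1 : Uᴴ * ρ * V = Matrix.diagonal (fun i => (l i : ℂ)) * W := by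
      rw [hρU, hW]
      calc _ = (Uᴴ * U) * Matrix.diagonal (fun i => (l i : ℂ)) * (Uᴴ * V) := by
            simp only [Matrix.mul_assoc]
        _ = _ := by rw [hU1, Matrix.one_mul]
    have h2 : Uᴴ * ρ * V = W * Matrix.diagonal (fun i => (d i : ℂ)) := by
      rw [hd, hW]
      calc _ = (Uᴴ * V) * Matrix.diagonal (fun i => (d i : ℂ)) * (Vᴴ * V) := by
            simp only [Matrix.mul_assoc]
        _ = _ := by rw [hV, Matrix.mul_one]
    rw [← h1, h2]
  have hent : ∀ i a, W i a ≠ 0 → l i = d a := by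
    intro i a h
    have h3 := congrFun (congrFun hcomm i) a
    rw [Matrix.diagonal_mul, Matrix.mul_diagonal, mul_comm] at h3
    exact_mod_cast mul_left_cancel₀ h h3
  have hB : Uᴴ * B * U = W * (Vᴴ * B * V) * Wᴴ := by
    rw [hW, Matrix.conjTranspose_mul, Matrix.conjTranspose_conjTranspose]
    calc _ = Uᴴ * (V * Vᴴ) * B * (V * Vᴴ) * U := by rw [hV2]; simp [Matrix.mul_assoc]
      _ = _ := by simp only [Matrix.mul_assoc]
  have key : (Matrix.of fun i j => ((c (l i) (l j) : ℝ) : ℂ) * (Uᴴ * B * U) i j)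
      = W * (Matrix.of fun i j => ((c (d i) (d j) : ℝ) : ℂ) * (Vᴴ * B * V) i j) * Wᴴ := by
    ext i j
    rw [hB, Matrix.of_apply]
    generalize Vᴴ * B * V = X
    simp only [Matrix.mul_apply, Matrix.of_apply, Matrix.conjTranspose_apply, Finset.mul_sum,
      Finset.sum_mul]
    refine Finset.sum_congr rfl fun b _ => Finset.sum_congr rfl fun a _ => ?_
    by_cases h1 : W i a = 0
    · simp [h1]
    by_cases h2 : W j b = 0
    · simp [h2]
    rw [hent i a h1, hent j b h2]
    ring
  have hUW : U * W = V := by rw [hW, ← Matrix.mul_assoc, hU2, Matrix.one_mul]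
  have hWU : Wᴴ * Uᴴ = Vᴴ := by rw [← Matrix.conjTranspose_mul, hUW]
  calc functionOfLR c hρ B
      = U * (Matrix.of fun i j => ((c (l i) (l j) : ℝ) : ℂ) * (Uᴴ * B * U) i j) * Uᴴ := rfl
    _ = (U * W) * (Matrix.of fun i j => ((c (d i) (d j) : ℝ) : ℂ) * (Vᴴ * B * V) i j)
          * (Wᴴ * Uᴴ) := by rw [key]; simp only [Matrix.mul_assoc]
    _ = _ := by rw [hUW, hWU]

open Classical in
/-- The metric `⟨A, B⟩_{ρ,f} = Tr(A c_f(L_ρ, R_ρ)(B))`. The trace is real for Hermitian `A`, `B`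
and symmetric `c_f`. Only positive definite `ρ` matter; for non-Hermitian `ρ` the value is `0` by
convention. -/
def metric {n : ℕ} (f : ℝ → ℝ) (ρ A B : Matrix (Fin n) (Fin n) ℂ) : ℝ :=
  if hρ : ρ.IsHermitian then
    (Matrix.trace (A * functionOfLR (chentsovMorozova f) hρ B)).re
  else 0

/-! ### Scalar curvature of a Riemannian metric given in coordinates -/

section Coordinates

variable {ι : Type*} [Fintype ι] [DecidableEq ι]

/-- The partial derivative `∂ᵢ F` at `x`. -/
def partialDeriv (i : ι) (F : (ι → ℝ) → ℝ) (x : ι → ℝ) : ℝ :=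
  lineDeriv ℝ F x (Pi.single i 1)

/-- The Christoffel symbol
`Γᵏᵢⱼ = ½ ∑ₗ gᵏˡ (∂ᵢ gⱼₗ + ∂ⱼ gᵢₗ - ∂ₗ gᵢⱼ)` of the Levi-Civita connection. -/
def christoffel (g : (ι → ℝ) → Matrix ι ι ℝ) (k i j : ι) (x : ι → ℝ) : ℝ :=
  (1 / 2) * ∑ l, (g x)⁻¹ k l *
    (partialDeriv i (fun y => g y j l) x + partialDeriv j (fun y => g y i l) x
      - partialDeriv l (fun y => g y i j) x)

/-- The component along `∂ₗ` of the Riemann curvature `R(∂ᵢ, ∂ⱼ) ∂ₖ`, where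
`R(X, Y) Z = ∇_X ∇_Y Z - ∇_Y ∇_X Z - ∇_[X,Y] Z`. -/
def riemann (g : (ι → ℝ) → Matrix ι ι ℝ) (l i j k : ι) (x : ι → ℝ) : ℝ :=
  partialDeriv i (christoffel g l j k) x - partialDeriv j (christoffel g l i k) x
    + ∑ m, (christoffel g l i m x * christoffel g m j k x
      - christoffel g l j m x * christoffel g m i k x)

/-- The Ricci curvature `Ric(∂ⱼ, ∂ₖ)`, the trace of `X ↦ R(X, ∂ⱼ) ∂ₖ`. -/
def ricci (g : (ι → ℝ) → Matrix ι ι ℝ) (j k : ι) (x : ι → ℝ) : ℝ :=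
  ∑ i, riemann g i i j k x

/-- The scalar curvature, the trace of the Ricci curvature with respect to the metric. -/
def scalarCurvature (g : (ι → ℝ) → Matrix ι ι ℝ) (x : ι → ℝ) : ℝ :=
  ∑ j, ∑ k, (g x)⁻¹ j k * ricci g j k x

end Coordinates

/-! ### Scalar curvature on the manifold of density matrices -/

/-- A basis of the tangent space (scalar curvature does not depend on this choice). -/
def tangentBasis (n : ℕ) :
    Module.Basis (Fin (Module.finrank ℝ (tangentSpace n))) ℝ (tangentSpace n) :=
  Module.finBasis ℝ (tangentSpace n)

/-- The affine chart `x ↦ ρ + ∑ᵢ xᵢ bᵢ` of the manifold of density matrices centred at `ρ`, where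
`bᵢ` is a basis of the Hermitian matrices of trace zero. -/
def affineChart {n : ℕ} (ρ : Matrix (Fin n) (Fin n) ℂ)
    (x : Fin (Module.finrank ℝ (tangentSpace n)) → ℝ) : Matrix (Fin n) (Fin n) ℂ :=
  ρ + ∑ i, x i • (tangentBasis n i : Matrix (Fin n) (Fin n) ℂ)

/-- The components in the affine chart centred at `ρ` of the metric associated with `f`. -/
def metricInChart {n : ℕ} (f : ℝ → ℝ) (ρ : Matrix (Fin n) (Fin n) ℂ)
    (x : Fin (Module.finrank ℝ (tangentSpace n)) → ℝ) :
    Matrix (Fin (Module.finrank ℝ (tangentSpace n)))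
      (Fin (Module.finrank ℝ (tangentSpace n))) ℝ :=
  Matrix.of fun i j => metric f (affineChart ρ x) (tangentBasis n i) (tangentBasis n j)

/-- `Scal_f(ρ)`: the scalar curvature at `ρ` of the manifold of density matrices with the metric
associated with `f`. -/
def scal {n : ℕ} (f : ℝ → ℝ) (ρ : Matrix (Fin n) (Fin n) ℂ) : ℝ :=
  scalarCurvature (metricInChart f ρ) 0

/-! ### The BKM and WYD metrics, and the two conjectures -/

/-- The function `f₁(x) = (x - 1) / log x`, `x > 0`, of the BKM metric, with its continuous
extension `f₁(1) = 1`. -/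
def fBKM (x : ℝ) : ℝ := if x = 1 then 1 else (x - 1) / Real.log x

/-- The function
`f_p(x) = (1 / (p p̃)) (x - 1)² / ((x^(1/p) - 1) (x^(1/p̃) - 1))`, `x > 0`, of the WYD(p) metric,
for real `p ≠ 0, 1`, where `1/p + 1/p̃ = 1`, with its continuous extension `f_p(1) = 1`; for
`p = 1` it is the function of the BKM metric. -/
def fWYD (p x : ℝ) : ℝ :=
  if p = 1 then fBKM x
  else if x = 1 then 1
  else (1 / (p * (p / (p - 1)))) *
    ((x - 1) ^ 2 / ((x ^ (1 / p) - 1) * (x ^ (1 / (p / (p - 1))) - 1)))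

/-- For some `ε > 0` the scalar curvature of the WYD(p) metric on the `n × n` density matrices is
Schur-increasing for all `p` in `(1, 1 + ε)`. -/
def WYDConjecture (n : ℕ) : Prop :=
  ∃ ε : ℝ, 0 < ε ∧ ∀ p ∈ Set.Ioo 1 (1 + ε), SchurIncreasingOn (scal (fWYD p)) (densityMatrices n)

/-- The scalar curvature of the BKM metric on the `n × n` density matrices is Schur-increasing. -/
def PetzConjecture (n : ℕ) : Prop :=
  SchurIncreasingOn (scal fBKM) (densityMatrices n)

end QuantumGeometry

end

/-!
For a fixed density matrix `ρ` the scalar curvature `scal (fWYD p) ρ` is a continuous function of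
`p > 0` (`continuousAt_scal_fWYD`), and `fWYD 1 = fBKM`. Hence an inequality between scalar
curvatures at two density matrices that holds for all `p > 1` close to `1` passes to the limit.

The scalar curvature is a rational expression in the components of the metric and their first two
derivatives, so it suffices that the components are smooth jointly in `p` and in the point, and
that the metric is nondegenerate (`contDiffOn_scalarCurvature`, `det_metricInChart_ne_zero`).

Joint smoothness comes from a formula for the Chentsov–Morozova function in which the singularities
at `x = y` and at `p = 1` are absent. With `φ(z) = (exp z - 1) / z`, an entire function, and
`Δ = log x - log y`,
`c(x, y) = y⁻¹ φ(Δ / p) φ((1 - 1 / p) Δ) φ(Δ)⁻²` (`chentsovMorozova_fWYD`).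
The right-hand side makes sense for elements `x`, `y` of a Banach algebra, with `φ` and `log` given
by their power series (`wydFunction`), and it is smooth in `p`, `x` and `y`. Applied to the operators
`L_ρ` and `R_ρ` it yields `c(L_ρ, R_ρ)`: for Hermitian `ρ` both operators lie in the image of a
homomorphism from an algebra of real arrays (`schurHom`), on which power series and inverses are
computed entrywise (`wydFunction_algHom`).
-/

open scoped Matrix ComplexOrder

noncomputable section

namespace QuantumGeometry

open Filter Topology FormalMultilinearSeries
open scoped ContDiff

/-! ### Power series in a Banach algebra -/

/-- The coefficients `1 / (k + 1)!` of the entire function `(exp z - 1) / z`. -/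
def expDivCoeff (k : ℕ) : ℝ := ((k + 1).factorial : ℝ)⁻¹

/-- The coefficients of `log (1 - w) = -∑ wᵏ / k`; the constant coefficient is `-0⁻¹ = 0`. -/
def logCoeff (k : ℕ) : ℝ := -(k : ℝ)⁻¹

theorem tendsto_expDivCoeff_ratio :
    Tendsto (fun k ↦ ‖expDivCoeff k.succ‖ / ‖expDivCoeff k‖) atTop (𝓝 0) := by
  have h : ∀ k : ℕ, ‖expDivCoeff k.succ‖ / ‖expDivCoeff k‖ = 1 / ((k + 1 : ℕ) + 1 : ℝ) := by
    intro k
    have h1 : ((k + 1).factorial : ℝ) ≠ 0 := by positivity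
    have h2 : ((k + 1 : ℕ) + 1 : ℝ) ≠ 0 := by positivity
    simp only [expDivCoeff, norm_inv, Real.norm_natCast, Nat.succ_eq_add_one]
    rw [Nat.factorial_succ (k + 1)]
    push_cast at h2 ⊢
    field_simp
  simp_rw [h]
  exact (tendsto_add_atTop_iff_nat (f := fun k : ℕ ↦ 1 / ((k : ℝ) + 1)) 1).2
    tendsto_one_div_add_atTop_nhds_zero_nat

theorem tendsto_logCoeff_ratio :
    Tendsto (fun k ↦ ‖logCoeff k.succ‖ / ‖logCoeff k‖) atTop (𝓝 1) := by
  have h : ∀ k : ℕ, ‖logCoeff k.succ‖ / ‖logCoeff k‖ = (k : ℝ) / ((k : ℝ) + 1) := by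
    intro k
    simp only [logCoeff, norm_neg, norm_inv, Real.norm_natCast, Nat.succ_eq_add_one]
    rw [div_inv_eq_mul, mul_comm, div_eq_mul_inv]
    push_cast
    rfl
  simp_rw [h]
  exact tendsto_natCast_div_add_atTop 1

section Series

variable {𝒜 : Type*} [NormedRing 𝒜] [NormedAlgebra ℝ 𝒜] [CompleteSpace 𝒜]

theorem contDiffAt_ofScalarsSum {c : ℕ → ℝ} {a : 𝒜}
    (ha : a ∈ Metric.eball (0 : 𝒜) (ofScalars 𝒜 c).radius) :
    ContDiffAt ℝ ∞ (ofScalarsSum c : 𝒜 → 𝒜) a :=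
  (((ofScalars 𝒜 c).hasFPowerSeriesOnBall (pos_of_gt (Metric.mem_eball.1 ha))).analyticAt_of_mem
    ha).contDiffAt

theorem contDiffAt_expDiv (a : 𝒜) :
    ContDiffAt ℝ ∞ (ofScalarsSum expDivCoeff : 𝒜 → 𝒜) a := by
  apply contDiffAt_ofScalarsSum
  rw [ofScalars_radius_eq_top_of_tendsto 𝒜 expDivCoeff
    (Eventually.of_forall fun k => inv_ne_zero (by positivity)) tendsto_expDivCoeff_ratio]
  simp

theorem contDiffAt_logSeries {a : 𝒜} (ha : ‖a‖ < 1) :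
    ContDiffAt ℝ ∞ (ofScalarsSum logCoeff : 𝒜 → 𝒜) a := by
  apply contDiffAt_ofScalarsSum
  have h := inv_le_ofScalars_radius_of_tendsto 𝒜 logCoeff (r := 1) one_ne_zero
    (by simpa using tendsto_logCoeff_ratio)
  refine Metric.eball_subset_eball h ?_
  simpa [← ofReal_norm] using ha

omit [CompleteSpace 𝒜] in
/-- Real functions given by power series are computed componentwise in any diagonalization
`Φ : ℝ^κ → 𝒜`. -/
theorem ofScalarsSum_algHom {κ : Type*} [Finite κ] {Φ : (κ → ℝ) →ₐ[ℝ] 𝒜}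
    (hΦ : Continuous Φ) {c : ℕ → ℝ} {μ s : κ → ℝ}
    (h : ∀ k, HasSum (fun m : ℕ => c m * μ k ^ m) (s k)) :
    ofScalarsSum c (Φ μ) = Φ s := by
  have h1 : HasSum (fun m : ℕ => c m • μ ^ m) s := Pi.hasSum.2 fun k => by simpa using h k
  have h2 := h1.map Φ hΦ
  rw [ofScalars_sum_eq, ← h2.tsum_eq]
  simp

end Series

/-- The function `(exp z - 1) / z`, with its continuous extension by `1` at `0`. -/
def expDiv (z : ℝ) : ℝ := if z = 0 then 1 else (Real.exp z - 1) / z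

theorem hasSum_expDiv (z : ℝ) : HasSum (fun m : ℕ => expDivCoeff m * z ^ m) (expDiv z) := by
  rcases eq_or_ne z 0 with rfl | hz
  · convert hasSum_single (f := fun m : ℕ => expDivCoeff m * 0 ^ m) 0 ?_ using 1
    · simp [expDiv, expDivCoeff]
    · intro m hm
      simp [hm]
  · have h := NormedSpace.expSeries_div_hasSum_exp (𝔸 := ℝ) z
    rw [← Real.exp_eq_exp_ℝ] at h
    have h1 := (hasSum_nat_add_iff' 1).2 h
    have h2 := h1.div_const z
    simp only [expDiv, hz, if_false]
    have h3 : ∀ m : ℕ, z ^ (m + 1) / ((m + 1).factorial : ℝ) / z = expDivCoeff m * z ^ m := by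
      intro m
      simp only [expDivCoeff, pow_succ]
      field_simp
    simpa [h3] using h2

theorem expDiv_pos (z : ℝ) : 0 < expDiv z := by
  unfold expDiv
  split_ifs with hz
  · exact one_pos
  · rcases lt_or_gt_of_ne hz with h | h
    · exact div_pos_of_neg_of_neg (by linarith [Real.exp_lt_one_iff.2 h]) h
    · exact div_pos (by linarith [Real.one_lt_exp_iff.2 h]) h

theorem hasSum_logSeries {w : ℝ} (hw : |w| < 1) :
    HasSum (fun m : ℕ => logCoeff m * w ^ m) (Real.log (1 - w)) := by
  have h := (Real.hasSum_pow_div_log_of_abs_lt_one hw).neg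
  rw [neg_neg] at h
  rw [← hasSum_nat_add_iff' 1]
  convert h using 1
  · ext m
    simp [logCoeff]
    ring
  · simp [logCoeff]

/-! ### The Chentsov–Morozova function of the WYD metrics as an analytic operator function -/

/-- The reciprocal of `f_p` in exponential coordinates, where the removable singularities at `x = 1`
and at `p = 1` have become values of the entire function `expDiv`. -/
theorem inv_fWYD_exp {p : ℝ} (hp : 0 < p) (z : ℝ) :
    (fWYD p (Real.exp z))⁻¹ = expDiv (p⁻¹ * z) * expDiv ((1 - p⁻¹) * z) / expDiv z ^ 2 := by
  rcases eq_or_ne z 0 with rfl | hz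
  · simp [fWYD, fBKM, expDiv]
  have he : Real.exp z ≠ 1 := by simpa using hz
  have he' : Real.exp z - 1 ≠ 0 := sub_ne_zero.2 he
  rcases eq_or_ne p 1 with rfl | hp1
  · simp [fWYD, fBKM, expDiv, hz]
    field_simp
  have hq : (1 - p⁻¹) ≠ 0 := by
    rw [sub_ne_zero]
    simpa [eq_comm] using hp1
  have hq2 : 1 / (p / (p - 1)) = 1 - p⁻¹ := by field_simp
  simp only [fWYD, hp1, he, if_false, expDiv, hz, mul_eq_zero, inv_eq_zero, hp.ne', hq, or_self,
    hq2, ← Real.exp_mul, mul_comm z, one_div]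
  have h1 : Real.exp (p⁻¹ * z) - 1 ≠ 0 := by
    rw [sub_ne_zero]; simp [hz, hp.ne']
  have h2 : Real.exp ((1 - p⁻¹) * z) - 1 ≠ 0 := by
    rw [sub_ne_zero]; simp [hz, hq]
  generalize Real.exp (p⁻¹ * z) - 1 = u at *
  generalize Real.exp ((1 - p⁻¹) * z) - 1 = v at *
  generalize Real.exp z - 1 = w at *
  field_simp

theorem chentsovMorozova_fWYD {p x y : ℝ} (hp : 0 < p) (hx : 0 < x) (hy : 0 < y) :
    chentsovMorozova (fWYD p) x y =
      y⁻¹ * (expDiv (p⁻¹ * (Real.log x - Real.log y))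
        * expDiv ((1 - p⁻¹) * (Real.log x - Real.log y))
        * (expDiv (Real.log x - Real.log y) ^ 2)⁻¹) := by
  rw [← div_eq_mul_inv, ← inv_fWYD_exp hp, ← Real.log_div hx.ne' hy.ne',
    Real.exp_log (div_pos hx hy), chentsovMorozova, one_div, mul_inv]

theorem chentsovMorozova_fWYD_pos {p x y : ℝ} (hp : 0 < p) (hx : 0 < x) (hy : 0 < y) :
    0 < chentsovMorozova (fWYD p) x y := by
  rw [chentsovMorozova_fWYD hp hx hy]
  have := expDiv_pos (p⁻¹ * (Real.log x - Real.log y))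
  have := expDiv_pos ((1 - p⁻¹) * (Real.log x - Real.log y))
  have := expDiv_pos (Real.log x - Real.log y)
  positivity

section Operator

variable {𝒜 : Type*} [NormedRing 𝒜] [NormedAlgebra ℝ 𝒜]

/-- The element `log l - log r`, for commuting `l` and `r`. The logarithm is expanded around `s⁻¹`,
and the additive constant `log s⁻¹` cancels. -/
def logDiff (s : ℝ) (l r : 𝒜) : 𝒜 :=
  ofScalarsSum logCoeff (1 - s • l) - ofScalarsSum logCoeff (1 - s • r)

/-- The element `c(l, r)`, for commuting `l` and `r`, where `c` is the Chentsov–Morozova function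
of the WYD(`p`) metric. It makes sense also for non-commuting `l` and `r`, which is convenient for
differentiation. -/
def wydFunction (s p : ℝ) (l r : 𝒜) : 𝒜 :=
  Ring.inverse r * (ofScalarsSum expDivCoeff (p⁻¹ • logDiff s l r)
    * ofScalarsSum expDivCoeff ((1 - p⁻¹) • logDiff s l r)
    * Ring.inverse (ofScalarsSum expDivCoeff (logDiff s l r) ^ 2))

/-- A homomorphism from `ℝ^κ` carries entrywise inverses to inverses. -/
theorem ringInverse_algHom {κ : Type*} (Φ : (κ → ℝ) →ₐ[ℝ] 𝒜) {μ : κ → ℝ}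
    (hμ : ∀ k, μ k ≠ 0) :
    IsUnit (Φ μ) ∧ Ring.inverse (Φ μ) = Φ (fun k => (μ k)⁻¹) := by
  have h : μ * (fun k => (μ k)⁻¹) = 1 := by ext k; simp [hμ k]
  have h1 : Φ μ * Φ (fun k => (μ k)⁻¹) = 1 := by rw [← map_mul, h, map_one]
  have h2 : Φ (fun k => (μ k)⁻¹) * Φ μ = 1 := by rw [← map_mul, mul_comm, h, map_one]
  exact ⟨⟨⟨_, _, h1, h2⟩, rfl⟩, Ring.inverse_unit (⟨_, _, h1, h2⟩ : 𝒜ˣ)⟩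

section Diagonal

variable {κ : Type*} [Finite κ] {Φ : (κ → ℝ) →ₐ[ℝ] 𝒜} (hΦ : Continuous Φ)
  {s : ℝ} (hs : 0 < s) {x y : κ → ℝ} (hx : ∀ k, |1 - s * x k| < 1) (hy : ∀ k, |1 - s * y k| < 1)

omit [Finite κ] in
include hs hx in
theorem pos_of_abs_one_sub_mul_lt (k : κ) : 0 < x k := by
  have := (abs_lt.1 (hx k)).2
  exact pos_of_mul_pos_right (a := s) (by linarith) hs.le

include hΦ hs hx hy

/-- The power series `logDiff` computes `log x - log y` when `s x` and `s y` lie within distance `1`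
of `1`. -/
theorem logDiff_algHom :
    logDiff s (Φ x) (Φ y) = Φ (fun k => Real.log (x k) - Real.log (y k)) := by
  have key : ∀ z : κ → ℝ, (∀ k, |1 - s * z k| < 1) →
      ofScalarsSum logCoeff (1 - s • Φ z) = Φ (fun k => Real.log s + Real.log (z k)) := by
    intro z hz
    have h : 1 - s • Φ z = Φ (fun k => 1 - s * z k) := by
      rw [← map_smul, ← map_one Φ, ← map_sub]
      rfl
    rw [h]
    refine ofScalarsSum_algHom hΦ fun k => ?_
    have := hasSum_logSeries (hz k)
    rwa [sub_sub_cancel, Real.log_mul hs.ne' (pos_of_abs_one_sub_mul_lt hs hz k).ne'] at this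
  rw [logDiff, key x hx, key y hy, ← map_sub]
  congr 1
  ext k
  simp

theorem isUnit_expDiv_logDiff_algHom :
    IsUnit (ofScalarsSum expDivCoeff (logDiff s (Φ x) (Φ y))) := by
  rw [logDiff_algHom hΦ hs hx hy, ofScalarsSum_algHom hΦ fun k => hasSum_expDiv _]
  exact (ringInverse_algHom Φ fun k => (expDiv_pos _).ne').1

/-- On simultaneously diagonalized elements `wydFunction` is the Chentsov–Morozova function of the
eigenvalues. -/
theorem wydFunction_algHom {p : ℝ} (hp : 0 < p) :
    wydFunction s p (Φ x) (Φ y) = Φ (fun k => chentsovMorozova (fWYD p) (x k) (y k)) := by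
  have hx0 := pos_of_abs_one_sub_mul_lt hs hx
  have hy0 := pos_of_abs_one_sub_mul_lt hs hy
  rw [wydFunction, logDiff_algHom hΦ hs hx hy, ← map_smul, ← map_smul,
    ofScalarsSum_algHom hΦ fun k => hasSum_expDiv _,
    ofScalarsSum_algHom hΦ fun k => hasSum_expDiv _,
    ofScalarsSum_algHom hΦ fun k => hasSum_expDiv _,
    (ringInverse_algHom Φ fun k => (hy0 k).ne').2, ← map_pow,
    (ringInverse_algHom Φ (μ := _ ^ 2) fun k => pow_ne_zero 2 (expDiv_pos _).ne').2,
    ← map_mul, ← map_mul, ← map_mul]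
  congr 1
  ext k
  simp [chentsovMorozova_fWYD hp (hx0 k) (hy0 k)]

end Diagonal

/-- Joint smoothness in the parameter and in both arguments; nothing has to commute, so `l` and `r`
may be differentiated in arbitrary directions. -/
theorem contDiffAt_wydFunction [CompleteSpace 𝒜] {E : Type*} [NormedAddCommGroup E]
    [NormedSpace ℝ E] {s : ℝ} {p : E → ℝ} {l r : E → 𝒜} {e : E}
    (hp : ContDiffAt ℝ ∞ p e) (hl : ContDiffAt ℝ ∞ l e) (hr : ContDiffAt ℝ ∞ r e)
    (hp0 : p e ≠ 0) (hl1 : ‖1 - s • l e‖ < 1) (hr1 : ‖1 - s • r e‖ < 1) (hru : IsUnit (r e))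
    (hu : IsUnit (ofScalarsSum expDivCoeff (logDiff s (l e) (r e)))) :
    ContDiffAt ℝ ∞ (fun e => wydFunction s (p e) (l e) (r e)) e := by
  have hD : ContDiffAt ℝ ∞ (fun e => logDiff s (l e) (r e)) e :=
    ((contDiffAt_logSeries hl1).comp e (contDiffAt_const.sub (hl.const_smul s))).sub
      ((contDiffAt_logSeries hr1).comp e (contDiffAt_const.sub (hr.const_smul s)))
  have hp' : ContDiffAt ℝ ∞ (fun e => (p e)⁻¹) e := hp.inv hp0
  have hinv : ∀ {g : E → 𝒜}, ContDiffAt ℝ ∞ g e → IsUnit (g e) →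
      ContDiffAt ℝ ∞ (fun e => Ring.inverse (g e)) e := by
    intro g hg ⟨u, hu⟩
    exact ContDiffAt.comp e (hu ▸ contDiffAt_ringInverse ℝ u) hg
  exact (hinv hr hru).mul ((((contDiffAt_expDiv _).comp e (hp'.smul hD)).mul
    ((contDiffAt_expDiv _).comp e ((contDiffAt_const.sub hp').smul hD))).mul
    (hinv (((contDiffAt_expDiv _).comp e hD).pow 2) (hu.pow 2)))

end Operator

/-! ### Operators on matrices that are diagonal with respect to matrix units -/

/-- The Banach algebra of bounded operators on a real normed space. For matrices the topology is
thereby the one of the chosen norm, not the product topology instance, from which it differs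
syntactically. -/
abbrev NormedEnd (V : Type*) [NormedAddCommGroup V] [NormedSpace ℝ V] : Type _ := V →L[ℝ] V

theorem completeSpace_normedEnd (V : Type*) [NormedAddCommGroup V] [NormedSpace ℝ V]
    [FiniteDimensional ℝ V] : CompleteSpace (NormedEnd V) :=
  have := FiniteDimensional.complete ℝ V
  inferInstance

section SchurMultiplier

open scoped Matrix.Norms.Frobenius

variable {n : ℕ}

theorem frobenius_norm_sq (A : Matrix (Fin n) (Fin n) ℂ) :
    ‖A‖ ^ 2 = ∑ i, ∑ j, ‖A i j‖ ^ 2 := by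
  rw [Matrix.frobenius_norm_def, ← Real.sqrt_eq_rpow, Real.sq_sqrt (by positivity)]
  simp

theorem frobenius_norm_sq_eq_trace (A : Matrix (Fin n) (Fin n) ℂ) :
    ((‖A‖ ^ 2 : ℝ) : ℂ) = (Aᴴ * A).trace := by
  rw [frobenius_norm_sq, Finset.sum_comm]
  simp [Matrix.trace, Matrix.mul_apply, Complex.conj_mul']

theorem frobenius_norm_unitary_conj (U : Matrix.unitaryGroup (Fin n) ℂ)
    (A : Matrix (Fin n) (Fin n) ℂ) : ‖U.1 * A * (U.1)ᴴ‖ = ‖A‖ := by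
  have hU : (U.1)ᴴ * U.1 = 1 := (Matrix.mem_unitaryGroup_iff').1 U.2
  have h : ‖U.1 * A * (U.1)ᴴ‖ ^ 2 = ‖A‖ ^ 2 := by
    apply Complex.ofReal_injective
    rw [frobenius_norm_sq_eq_trace, frobenius_norm_sq_eq_trace]
    have h1 : (U.1 * A * (U.1)ᴴ)ᴴ * (U.1 * A * (U.1)ᴴ) = U.1 * (Aᴴ * A * (U.1)ᴴ) := by
      simp only [Matrix.conjTranspose_mul, Matrix.conjTranspose_conjTranspose]
      calc _ = U.1 * (Aᴴ * ((U.1)ᴴ * U.1) * A * (U.1)ᴴ) := by simp only [Matrix.mul_assoc]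
        _ = _ := by rw [hU, Matrix.mul_one]
    rw [h1, Matrix.trace_mul_comm, Matrix.mul_assoc, hU, Matrix.mul_one]
  exact (pow_left_inj₀ (norm_nonneg _) (norm_nonneg _) two_ne_zero).1 h

/-- The matrix `B` with its entries in the basis `U` multiplied by the real numbers `μ`. -/
def schurMul (U : Matrix.unitaryGroup (Fin n) ℂ) (μ : Fin n × Fin n → ℝ)
    (B : Matrix (Fin n) (Fin n) ℂ) : Matrix (Fin n) (Fin n) ℂ :=
  U.1 * (Matrix.of fun i j => ((μ (i, j) : ℝ) : ℂ) * ((U.1)ᴴ * B * U.1) i j) * (U.1)ᴴ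

theorem conj_schurMul (U : Matrix.unitaryGroup (Fin n) ℂ) (μ : Fin n × Fin n → ℝ)
    (B : Matrix (Fin n) (Fin n) ℂ) : (U.1)ᴴ * schurMul U μ B * U.1 =
      Matrix.of fun i j => ((μ (i, j) : ℝ) : ℂ) * ((U.1)ᴴ * B * U.1) i j := by
  have hU : (U.1)ᴴ * U.1 = 1 := (Matrix.mem_unitaryGroup_iff').1 U.2
  rw [schurMul]
  generalize (Matrix.of fun i j => ((μ (i, j) : ℝ) : ℂ) * ((U.1)ᴴ * B * U.1) i j) = X
  calc _ = ((U.1)ᴴ * U.1) * X * ((U.1)ᴴ * U.1) := by simp only [Matrix.mul_assoc]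
    _ = _ := by rw [hU, Matrix.one_mul, Matrix.mul_one]

theorem conj_conj_unitary (U : Matrix.unitaryGroup (Fin n) ℂ) (B : Matrix (Fin n) (Fin n) ℂ) :
    U.1 * ((U.1)ᴴ * B * U.1) * (U.1)ᴴ = B := by
  have hU : U.1 * (U.1)ᴴ = 1 := (Matrix.mem_unitaryGroup_iff).1 U.2
  calc _ = (U.1 * (U.1)ᴴ) * B * (U.1 * (U.1)ᴴ) := by simp only [Matrix.mul_assoc]
    _ = _ := by rw [hU, Matrix.one_mul, Matrix.mul_one]

/-- Schur multiplication is bounded by the supremum of the multipliers because the Frobenius norm is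
invariant under unitary conjugation and depends only on the moduli of the entries. -/
theorem norm_schurMul_le (U : Matrix.unitaryGroup (Fin n) ℂ) (μ : Fin n × Fin n → ℝ)
    (B : Matrix (Fin n) (Fin n) ℂ) : ‖schurMul U μ B‖ ≤ ‖μ‖ * ‖B‖ := by
  rw [schurMul, frobenius_norm_unitary_conj]
  conv_rhs => rw [← conj_conj_unitary U B, frobenius_norm_unitary_conj]
  refine (pow_le_pow_iff_left₀ (norm_nonneg _) (by positivity) two_ne_zero).1 ?_
  rw [mul_pow, frobenius_norm_sq, frobenius_norm_sq, Finset.mul_sum]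
  refine Finset.sum_le_sum fun i _ => ?_
  rw [Finset.mul_sum]
  refine Finset.sum_le_sum fun j _ => ?_
  rw [Matrix.of_apply, norm_mul, mul_pow, Complex.norm_real]
  gcongr
  exact norm_le_pi_norm μ (i, j)

/-- The homomorphism from the algebra of real `n × n` arrays with entrywise multiplication to the
operators on complex matrices, that sends an array `μ` to the operator for which the matrix units
`U Eᵢⱼ U*` are eigenvectors with eigenvalues `μᵢⱼ`. -/
def schurHom (U : Matrix.unitaryGroup (Fin n) ℂ) : (Fin n × Fin n → ℝ) →ₐ[ℝ]
    NormedEnd (Matrix (Fin n) (Fin n) ℂ) :=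
  AlgHom.ofLinearMap
    { toFun := fun μ => LinearMap.mkContinuous
        { toFun := schurMul U μ
          map_add' := fun A B => by
            rw [schurMul, schurMul, schurMul, ← Matrix.add_mul, ← Matrix.mul_add]
            congr 2
            ext i j
            simp [Matrix.add_mul, mul_add]
          map_smul' := fun r A => by
            rw [RingHom.id_apply, schurMul, schurMul, ← Matrix.smul_mul, ← Matrix.mul_smul]
            congr 2
            ext i j
            simp [mul_left_comm] } ‖μ‖ (norm_schurMul_le U μ)
      map_add' := fun μ ν => by
        ext1 B
        change schurMul U (μ + ν) B = schurMul U μ B + schurMul U ν B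
        rw [schurMul, schurMul, schurMul, ← Matrix.add_mul, ← Matrix.mul_add]
        congr 2
        ext i j
        simp [add_mul]
      map_smul' := fun r μ => by
        ext1 B
        change schurMul U (r • μ) B = r • schurMul U μ B
        rw [schurMul, schurMul, ← Matrix.smul_mul, ← Matrix.mul_smul]
        congr 2
        ext i j
        simp [mul_assoc] }
    (by
      ext1 B
      change schurMul U 1 B = B
      rw [schurMul]
      conv_rhs => rw [← conj_conj_unitary U B]
      congr 2
      ext i j
      simp)
    (by
      intro μ ν
      ext1 B
      change schurMul U (μ * ν) B = schurMul U μ (schurMul U ν B)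
      rw [schurMul, schurMul.eq_1 U μ, conj_schurMul]
      congr 2
      ext i j
      simp [mul_assoc])

theorem schurHom_apply (U : Matrix.unitaryGroup (Fin n) ℂ) (μ : Fin n × Fin n → ℝ)
    (B : Matrix (Fin n) (Fin n) ℂ) : schurHom U μ B = schurMul U μ B := rfl

theorem continuous_schurHom (U : Matrix.unitaryGroup (Fin n) ℂ) : Continuous (schurHom U) :=
  (schurHom U).toLinearMap.continuous_of_finiteDimensional

theorem norm_schurHom_le (U : Matrix.unitaryGroup (Fin n) ℂ) (μ : Fin n × Fin n → ℝ) :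
    ‖schurHom U μ‖ ≤ ‖μ‖ :=
  ContinuousLinearMap.opNorm_le_bound _ (norm_nonneg _) (norm_schurMul_le U μ)

/-- The eigenvalues of an operator are bounded by its norm. -/
theorem abs_le_norm_schurHom (U : Matrix.unitaryGroup (Fin n) ℂ) (μ : Fin n × Fin n → ℝ)
    (k : Fin n × Fin n) : |μ k| ≤ ‖schurHom U μ‖ := by
  have hU : (U.1)ᴴ * U.1 = 1 := (Matrix.mem_unitaryGroup_iff').1 U.2
  set E : Matrix (Fin n) (Fin n) ℂ := Matrix.single k.1 k.2 1
  have hE : (U.1)ᴴ * (U.1 * E * (U.1)ᴴ) * U.1 = E := by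
    calc _ = ((U.1)ᴴ * U.1) * E * ((U.1)ᴴ * U.1) := by simp only [Matrix.mul_assoc]
      _ = _ := by rw [hU, Matrix.one_mul, Matrix.mul_one]
  have hpos : 0 < ‖U.1 * E * (U.1)ᴴ‖ := by
    rw [frobenius_norm_unitary_conj, norm_pos_iff]
    intro h
    have := congrFun (congrFun h k.1) k.2
    simp [E] at this
  have h : schurHom U μ (U.1 * E * (U.1)ᴴ) = μ k • (U.1 * E * (U.1)ᴴ) := by
    rw [schurHom_apply, schurMul, hE, ← Matrix.smul_mul, ← Matrix.mul_smul]
    congr 2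
    ext i j
    by_cases hij : k.1 = i ∧ k.2 = j
    · obtain ⟨rfl, rfl⟩ := hij
      simp [E]
    · simp [E, Matrix.single_apply, hij]
  have h2 := (schurHom U μ).le_opNorm (U.1 * E * (U.1)ᴴ)
  rw [h, norm_smul, Real.norm_eq_abs] at h2
  exact le_of_mul_le_mul_right h2 hpos

theorem spectral_conj {ρ : Matrix (Fin n) (Fin n) ℂ} (hρ : ρ.IsHermitian) :
    ρ = hρ.eigenvectorUnitary.1 * Matrix.diagonal (fun i => (hρ.eigenvalues i : ℂ))
      * (hρ.eigenvectorUnitary.1)ᴴ := by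
  have h := hρ.spectral_theorem
  rwa [Unitary.conjStarAlgAut_apply] at h

/-- Left multiplication by a matrix, as an element of a Banach algebra. -/
def leftMul (ρ : Matrix (Fin n) (Fin n) ℂ) : NormedEnd (Matrix (Fin n) (Fin n) ℂ) :=
  ContinuousLinearMap.mul ℝ (Matrix (Fin n) (Fin n) ℂ) ρ

/-- Right multiplication by a matrix, as an element of a Banach algebra. -/
def rightMul (ρ : Matrix (Fin n) (Fin n) ℂ) : NormedEnd (Matrix (Fin n) (Fin n) ℂ) :=
  (ContinuousLinearMap.mul ℝ (Matrix (Fin n) (Fin n) ℂ)).flip ρ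

theorem leftMul_apply (ρ B : Matrix (Fin n) (Fin n) ℂ) : leftMul ρ B = ρ * B := rfl

theorem rightMul_apply (ρ B : Matrix (Fin n) (Fin n) ℂ) : rightMul ρ B = B * ρ := rfl

/-- Left multiplication by a Hermitian matrix is diagonal in the matrix units of its
eigenvectors. -/
theorem leftMul_eq_schurHom {ρ : Matrix (Fin n) (Fin n) ℂ} (hρ : ρ.IsHermitian) :
    leftMul ρ = schurHom hρ.eigenvectorUnitary (fun k => hρ.eigenvalues k.1) := by
  ext1 B
  set U := hρ.eigenvectorUnitary
  rw [schurHom_apply, schurMul, leftMul_apply, ← conj_conj_unitary U (ρ * B)]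
  have hU : (U.1)ᴴ * U.1 = 1 := (Matrix.mem_unitaryGroup_iff').1 U.2
  congr 2
  have h : (U.1)ᴴ * (ρ * B) * U.1 =
      Matrix.diagonal (fun i => (hρ.eigenvalues i : ℂ)) * ((U.1)ᴴ * B * U.1) := by
    conv_lhs => rw [spectral_conj hρ]
    calc _ = ((U.1)ᴴ * U.1) * Matrix.diagonal (fun i => (hρ.eigenvalues i : ℂ))
          * ((U.1)ᴴ * B * U.1) := by simp only [U, Matrix.mul_assoc]
      _ = _ := by rw [hU, Matrix.one_mul]
  rw [h]
  ext i j
  rw [Matrix.diagonal_mul, Matrix.of_apply]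

/-- Right multiplication by a Hermitian matrix is diagonal in the matrix units of its
eigenvectors. -/
theorem rightMul_eq_schurHom {ρ : Matrix (Fin n) (Fin n) ℂ} (hρ : ρ.IsHermitian) :
    rightMul ρ = schurHom hρ.eigenvectorUnitary (fun k => hρ.eigenvalues k.2) := by
  ext1 B
  set U := hρ.eigenvectorUnitary
  rw [schurHom_apply, schurMul, rightMul_apply, ← conj_conj_unitary U (B * ρ)]
  have hU : (U.1)ᴴ * U.1 = 1 := (Matrix.mem_unitaryGroup_iff').1 U.2
  congr 2
  have h : (U.1)ᴴ * (B * ρ) * U.1 =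
      ((U.1)ᴴ * B * U.1) * Matrix.diagonal (fun i => (hρ.eigenvalues i : ℂ)) := by
    conv_lhs => rw [spectral_conj hρ]
    calc _ = ((U.1)ᴴ * B * U.1) * Matrix.diagonal (fun i => (hρ.eigenvalues i : ℂ))
          * ((U.1)ᴴ * U.1) := by simp only [U, Matrix.mul_assoc]
      _ = _ := by rw [hU, Matrix.mul_one]
  rw [h]
  ext i j
  rw [Matrix.mul_diagonal, Matrix.of_apply, mul_comm]

theorem functionOfLR_eq_schurHom (c : ℝ → ℝ → ℝ) {ρ : Matrix (Fin n) (Fin n) ℂ}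
    (hρ : ρ.IsHermitian) (B : Matrix (Fin n) (Fin n) ℂ) :
    functionOfLR c hρ B = schurHom hρ.eigenvectorUnitary
      (fun k => c (hρ.eigenvalues k.1) (hρ.eigenvalues k.2)) B := rfl

end SchurMultiplier

/-! ### Dependence of the scalar curvature on a parameter -/

section Parameter

open scoped ContDiff

variable {ι : Type*} [Fintype ι] [DecidableEq ι] {W : Set (ℝ × (ι → ℝ))}

theorem contDiffOn_partialDeriv (hW : IsOpen W) {F : ℝ → (ι → ℝ) → ℝ}
    (hF : ContDiffOn ℝ ∞ (fun q : ℝ × (ι → ℝ) => F q.1 q.2) W) (i : ι) :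
    ContDiffOn ℝ ∞ (fun q : ℝ × (ι → ℝ) => partialDeriv i (F q.1) q.2) W := by
  have h := (hF.fderiv_of_isOpen (m := ∞) hW (by simp)).clm_apply
    (contDiffOn_const (c := ((0 : ℝ), (Pi.single i 1 : ι → ℝ))))
  refine h.congr fun q hq => ?_
  have hd : DifferentiableAt ℝ (fun q : ℝ × (ι → ℝ) => F q.1 q.2) (q.1, q.2) :=
    (hF.contDiffAt (hW.mem_nhds hq)).differentiableAt (by simp)
  have h1 : HasFDerivAt (F q.1)
      ((fderiv ℝ (fun q : ℝ × (ι → ℝ) => F q.1 q.2) q).comp (ContinuousLinearMap.inr ℝ ℝ (ι → ℝ)))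
      q.2 := by
    have := hd.hasFDerivAt.comp q.2 (hasFDerivAt_prodMk_right q.1 q.2)
    exact this
  rw [partialDeriv, (h1.hasLineDerivAt _).lineDeriv]
  simp

variable {g : ℝ → (ι → ℝ) → Matrix ι ι ℝ}

theorem contDiffOn_det {M : ℝ × (ι → ℝ) → Matrix ι ι ℝ}
    (hM : ∀ i j, ContDiffOn ℝ ∞ (fun q => M q i j) W) :
    ContDiffOn ℝ ∞ (fun q => (M q).det) W := by
  simp only [Matrix.det_apply']
  exact ContDiffOn.sum fun σ _ => contDiffOn_const.mul (contDiffOn_prod fun i _ => hM _ _)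

theorem contDiffOn_inv_apply {M : ℝ × (ι → ℝ) → Matrix ι ι ℝ}
    (hM : ∀ i j, ContDiffOn ℝ ∞ (fun q => M q i j) W) (hdet : ∀ q ∈ W, (M q).det ≠ 0) (i j : ι) :
    ContDiffOn ℝ ∞ (fun q => (M q)⁻¹ i j) W := by
  simp only [Matrix.inv_def, Ring.inverse_eq_inv', Matrix.smul_apply, Matrix.adjugate_apply,
    smul_eq_mul]
  refine ((contDiffOn_det hM).inv hdet).mul (contDiffOn_det fun a b => ?_)
  simp only [Matrix.updateRow_apply]
  split_ifs
  · exact contDiffOn_const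
  · exact hM a b

theorem contDiffOn_christoffel (hW : IsOpen W)
    (hg : ∀ i j, ContDiffOn ℝ ∞ (fun q : ℝ × (ι → ℝ) => g q.1 q.2 i j) W)
    (hdet : ∀ q ∈ W, (g q.1 q.2).det ≠ 0) (k i j : ι) :
    ContDiffOn ℝ ∞ (fun q : ℝ × (ι → ℝ) => christoffel (g q.1) k i j q.2) W := by
  have hd : ∀ a b c, ContDiffOn ℝ ∞
      (fun q : ℝ × (ι → ℝ) => partialDeriv a (fun y => g q.1 y b c) q.2) W := fun a b c =>
    contDiffOn_partialDeriv hW (F := fun p y => g p y b c) (hg b c) a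
  exact contDiffOn_const.mul (ContDiffOn.sum fun l _ =>
    (contDiffOn_inv_apply hg hdet k l).mul (((hd i j l).add (hd j i l)).sub (hd l i j)))

/-- The scalar curvature of a nondegenerate metric that is smooth jointly in the point and in a
parameter is itself jointly smooth. -/
theorem contDiffOn_scalarCurvature (hW : IsOpen W)
    (hg : ∀ i j, ContDiffOn ℝ ∞ (fun q : ℝ × (ι → ℝ) => g q.1 q.2 i j) W)
    (hdet : ∀ q ∈ W, (g q.1 q.2).det ≠ 0) :
    ContDiffOn ℝ ∞ (fun q : ℝ × (ι → ℝ) => scalarCurvature (g q.1) q.2) W := by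
  have hc := contDiffOn_christoffel hW hg hdet
  have hd : ∀ a k i j, ContDiffOn ℝ ∞
      (fun q : ℝ × (ι → ℝ) => partialDeriv a (christoffel (g q.1) k i j) q.2) W := fun a k i j =>
    contDiffOn_partialDeriv hW (F := fun p => christoffel (g p) k i j) (hc k i j) a
  exact ContDiffOn.sum fun j _ => ContDiffOn.sum fun k _ =>
    (contDiffOn_inv_apply hg hdet j k).mul (ContDiffOn.sum fun i _ =>
      (((hd i i j k).sub (hd j i i k)).add (ContDiffOn.sum fun m _ =>
        ((hc i i m).mul (hc m j k)).sub ((hc i j m).mul (hc m i k)))))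

end Parameter

/-! ### Nondegeneracy of the metric -/

section Nondegenerate

variable {n : ℕ}

theorem functionOfLR_sum_smul (c : ℝ → ℝ → ℝ) {ρ : Matrix (Fin n) (Fin n) ℂ}
    (hρ : ρ.IsHermitian) {κ : Type*} [Fintype κ] (v : κ → ℝ)
    (B : κ → Matrix (Fin n) (Fin n) ℂ) :
    functionOfLR c hρ (∑ k, v k • B k) = ∑ k, v k • functionOfLR c hρ (B k) := by
  simp only [functionOfLR_eq_schurHom, map_sum, map_smul]

/-- The quadratic form of the metric in an eigenbasis of `ρ`. -/
theorem metric_self (f : ℝ → ℝ) {ρ A : Matrix (Fin n) (Fin n) ℂ} (hρ : ρ.IsHermitian)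
    (hA : A.IsHermitian) :
    metric f ρ A A = ∑ i, ∑ j, chentsovMorozova f (hρ.eigenvalues j) (hρ.eigenvalues i) *
      ‖((hρ.eigenvectorUnitary.1)ᴴ * A * hρ.eigenvectorUnitary.1) j i‖ ^ 2 := by
  rw [metric, dif_pos hρ, functionOfLR]
  set U := hρ.eigenvectorUnitary.1
  have hA' : (Uᴴ * A * U).IsHermitian := Matrix.isHermitian_conjTranspose_mul_mul U hA
  have h : ∀ X, (A * (U * X * Uᴴ)).trace = ((Uᴴ * A * U) * X).trace := fun X => by
    rw [← Matrix.mul_assoc, Matrix.trace_mul_comm]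
    simp only [Matrix.mul_assoc]
  rw [h]
  simp only [Matrix.trace, Matrix.diag, Matrix.mul_apply (M := Uᴴ * A * U), Complex.re_sum]
  refine Finset.sum_congr rfl fun i _ => Finset.sum_congr rfl fun j _ => ?_
  rw [← hA'.apply i j, Matrix.of_apply, mul_left_comm, Complex.star_def, Complex.conj_mul',
    Complex.re_ofReal_mul]
  norm_cast

/-- The metric associated with a function that is positive on pairs of eigenvalues is positive
definite. -/
theorem eq_zero_of_metric_self_eq_zero (f : ℝ → ℝ) {ρ A : Matrix (Fin n) (Fin n) ℂ}
    (hρ : ρ.IsHermitian) (hA : A.IsHermitian)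
    (hc : ∀ i j, 0 < chentsovMorozova f (hρ.eigenvalues i) (hρ.eigenvalues j))
    (h : metric f ρ A A = 0) : A = 0 := by
  rw [metric_self f hρ hA] at h
  have h1 : ∀ i j, 0 ≤ chentsovMorozova f (hρ.eigenvalues j) (hρ.eigenvalues i) *
      ‖((hρ.eigenvectorUnitary.1)ᴴ * A * hρ.eigenvectorUnitary.1) j i‖ ^ 2 := fun i j =>
    mul_nonneg (hc j i).le (by positivity)
  have h2 : (hρ.eigenvectorUnitary.1)ᴴ * A * hρ.eigenvectorUnitary.1 = 0 := by
    ext j i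
    have h3 := (Finset.sum_eq_zero_iff_of_nonneg fun i _ =>
      Finset.sum_nonneg fun j _ => h1 i j).1 h i (Finset.mem_univ i)
    have h4 := (Finset.sum_eq_zero_iff_of_nonneg fun j _ => h1 i j).1 h3 j (Finset.mem_univ j)
    simpa [(hc j i).ne'] using h4
  rw [← conj_conj_unitary hρ.eigenvectorUnitary A, h2]
  simp

/-- A null vector of the Gram matrix would be a tangent vector of length zero. -/
theorem det_metricInChart_ne_zero (f : ℝ → ℝ) (ρ : Matrix (Fin n) (Fin n) ℂ)
    (x : Fin (Module.finrank ℝ (tangentSpace n)) → ℝ) (hρ : (affineChart ρ x).IsHermitian)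
    (hc : ∀ i j, 0 < chentsovMorozova f (hρ.eigenvalues i) (hρ.eigenvalues j)) :
    (metricInChart f ρ x).det ≠ 0 := by
  intro h
  obtain ⟨v, hv, hv0⟩ := Matrix.exists_mulVec_eq_zero_iff.2 h
  set A : tangentSpace n := ∑ i, v i • tangentBasis n i with hA
  have hAc : (A : Matrix (Fin n) (Fin n) ℂ) =
      ∑ i, v i • (tangentBasis n i : Matrix (Fin n) (Fin n) ℂ) := by
    simp [hA]
  have hm : metric f (affineChart ρ x) A A = v ⬝ᵥ (metricInChart f ρ x *ᵥ v) := by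
    simp only [metricInChart, metric, dif_pos hρ, dotProduct, Matrix.mulVec, Matrix.of_apply]
    conv_lhs => rw [hAc, functionOfLR_sum_smul]
    simp only [Finset.sum_mul, Finset.mul_sum, Matrix.trace_sum, Complex.re_sum,
      Matrix.smul_mul, Matrix.mul_smul, Matrix.trace_smul, Complex.smul_re, smul_eq_mul]
    rw [Finset.sum_comm]
    refine Finset.sum_congr rfl fun i _ => Finset.sum_congr rfl fun j _ => ?_
    ring
  rw [hv0, dotProduct_zero] at hm
  have hA0 : A = 0 := Subtype.ext (eq_zero_of_metric_self_eq_zero f hρ A.2.1 hc hm)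
  apply hv
  ext i
  exact Fintype.linearIndependent_iff.1 (tangentBasis n).linearIndependent v (hA ▸ hA0) i

end Nondegenerate

/-! ### Continuity of the scalar curvature in the WYD parameter -/

section Continuity

open scoped Matrix.Norms.Frobenius ContDiff

variable {n : ℕ}

theorem isHermitian_affineChart {ρ : Matrix (Fin n) (Fin n) ℂ} (hρ : ρ.IsHermitian)
    (x : Fin (Module.finrank ℝ (tangentSpace n)) → ℝ) : (affineChart ρ x).IsHermitian := by
  have h : affineChart ρ x = ρ + (∑ i, x i • tangentBasis n i : tangentSpace n) := by
    simp [affineChart]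
  rw [h]
  exact hρ.add (∑ i, x i • tangentBasis n i : tangentSpace n).2.1

theorem contDiff_affineChart (ρ : Matrix (Fin n) (Fin n) ℂ) : ContDiff ℝ ∞ (affineChart ρ) :=
  contDiff_const.add (ContDiff.sum fun i _ => (contDiff_apply ℝ ℝ i).smul contDiff_const)

theorem contDiff_leftMul : ContDiff ℝ ∞ (leftMul (n := n)) :=
  (ContinuousLinearMap.mul ℝ (Matrix (Fin n) (Fin n) ℂ)).contDiff

theorem contDiff_rightMul : ContDiff ℝ ∞ (rightMul (n := n)) :=
  (ContinuousLinearMap.mul ℝ (Matrix (Fin n) (Fin n) ℂ)).flip.contDiff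

/-- The parameters and the points of the affine chart around `ρ` at which the operator logarithm,
expanded around `s⁻¹`, converges. -/
def logDomain (s : ℝ) (ρ : Matrix (Fin n) (Fin n) ℂ) :
    Set (ℝ × (Fin (Module.finrank ℝ (tangentSpace n)) → ℝ)) :=
  {q | 0 < q.1 ∧ ‖1 - s • leftMul (affineChart ρ q.2)‖ < 1 ∧
    ‖1 - s • rightMul (affineChart ρ q.2)‖ < 1}

theorem isOpen_logDomain (s : ℝ) (ρ : Matrix (Fin n) (Fin n) ℂ) : IsOpen (logDomain s ρ) := by
  have hl := (contDiff_leftMul.comp (contDiff_affineChart ρ)).continuous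
  have hr := (contDiff_rightMul.comp (contDiff_affineChart ρ)).continuous
  refine (isOpen_lt continuous_const continuous_fst).inter
    ((isOpen_lt (f := fun q : ℝ × (Fin (Module.finrank ℝ (tangentSpace n)) → ℝ) =>
        ‖1 - s • leftMul (affineChart ρ q.2)‖) ?_ continuous_const).inter
      (isOpen_lt (f := fun q : ℝ × (Fin (Module.finrank ℝ (tangentSpace n)) → ℝ) =>
        ‖1 - s • rightMul (affineChart ρ q.2)‖) ?_ continuous_const))
  · exact (continuous_const.sub ((hl.comp continuous_snd).const_smul s)).norm
  · exact (continuous_const.sub ((hr.comp continuous_snd).const_smul s)).norm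

theorem one_sub_smul_schurHom (U : Matrix.unitaryGroup (Fin n) ℂ) (s : ℝ)
    (μ : Fin n × Fin n → ℝ) :
    1 - s • schurHom U μ = schurHom U (fun k => 1 - s * μ k) := by
  rw [← map_smul, ← map_one (schurHom U), ← map_sub]
  rfl

/-- For a Hermitian matrix the norm bound forces all eigenvalues into `(0, 2 / s)`; in particular it
implies positive definiteness. -/
theorem abs_one_sub_mul_eigenvalues_lt {s : ℝ} {ρ : Matrix (Fin n) (Fin n) ℂ}
    (hρ : ρ.IsHermitian) (h : ‖1 - s • leftMul ρ‖ < 1) (i : Fin n) :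
    |1 - s * hρ.eigenvalues i| < 1 := by
  rw [leftMul_eq_schurHom hρ, one_sub_smul_schurHom] at h
  exact (abs_le_norm_schurHom _ _ (i, i)).trans_lt h

/-- Around every positive definite matrix there is an expansion of the operator logarithm. -/
theorem exists_mem_logDomain {ρ : Matrix (Fin n) (Fin n) ℂ} (hρ : ρ.PosDef) :
    ∃ s > 0, ∀ p > 0, (p, 0) ∈ logDomain s ρ := by
  have hpos := hρ.eigenvalues_pos
  set d := hρ.isHermitian.eigenvalues
  have hS : 0 ≤ ∑ i, d i := Finset.sum_nonneg fun i _ => (hpos i).le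
  -- The trace bounds every eigenvalue; adding `1` makes the bound strict and covers `n = 0`.
  refine ⟨(1 + ∑ i, d i)⁻¹, by positivity, fun p hp => ?_⟩
  have hd : ∀ i, |1 - (1 + ∑ i, d i)⁻¹ * d i| < 1 := by
    intro i
    have h1 : d i ≤ ∑ i, d i :=
      Finset.single_le_sum (f := d) (fun i _ => (hpos i).le) (Finset.mem_univ i)
    have h2 : 0 < (1 + ∑ i, d i)⁻¹ * d i := mul_pos (by positivity) (hpos i)
    have h3 : (1 + ∑ i, d i)⁻¹ * d i < 1 := by
      rw [inv_mul_lt_one₀ (by positivity)]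
      linarith
    rw [abs_lt]
    constructor <;> linarith
  have h0 : affineChart ρ 0 = ρ := by simp [affineChart]
  refine ⟨hp, ?_, ?_⟩
  · dsimp only
    rw [h0, leftMul_eq_schurHom hρ.isHermitian, one_sub_smul_schurHom]
    refine (norm_schurHom_le _ _).trans_lt ((pi_norm_lt_iff one_pos).2 fun k => hd k.1)
  · dsimp only
    rw [h0, rightMul_eq_schurHom hρ.isHermitian, one_sub_smul_schurHom]
    refine (norm_schurHom_le _ _).trans_lt ((pi_norm_lt_iff one_pos).2 fun k => hd k.2)

/-- The components of the WYD metrics are jointly smooth in the parameter and in the point. -/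
theorem contDiffOn_metricInChart {s : ℝ} (hs : 0 < s) {ρ : Matrix (Fin n) (Fin n) ℂ}
    (hρ : ρ.IsHermitian) (i j : Fin (Module.finrank ℝ (tangentSpace n))) :
    ContDiffOn ℝ ∞ (fun q : ℝ × (Fin (Module.finrank ℝ (tangentSpace n)) → ℝ) =>
      metricInChart (fWYD q.1) ρ q.2 i j) (logDomain s ρ) := by
  have := completeSpace_normedEnd (Matrix (Fin n) (Fin n) ℂ)
  set C : ℝ × (Fin (Module.finrank ℝ (tangentSpace n)) → ℝ) →
      NormedEnd (Matrix (Fin n) (Fin n) ℂ) := fun q =>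
    wydFunction s q.1 (leftMul (affineChart ρ q.2)) (rightMul (affineChart ρ q.2)) with hC
  have hC1 : ContDiffOn ℝ ∞ C (logDomain s ρ) := by
    intro q hq
    have hq' := isHermitian_affineChart hρ q.2
    have hd := abs_one_sub_mul_eigenvalues_lt hq' hq.2.1
    refine (contDiffAt_wydFunction contDiffAt_fst
      (((contDiff_leftMul.comp (contDiff_affineChart ρ)).comp contDiff_snd).contDiffAt)
      (((contDiff_rightMul.comp (contDiff_affineChart ρ)).comp contDiff_snd).contDiffAt)
      hq.1.ne' hq.2.1 hq.2.2 ?_ ?_).contDiffWithinAt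
    · rw [Function.comp_apply, Function.comp_apply, rightMul_eq_schurHom hq']
      exact (ringInverse_algHom _ (μ := fun k : Fin n × Fin n => hq'.eigenvalues k.2) fun k =>
        (pos_of_abs_one_sub_mul_lt hs hd k.2).ne').1
    · simp only [Function.comp_apply]
      rw [leftMul_eq_schurHom hq', rightMul_eq_schurHom hq']
      exact isUnit_expDiv_logDiff_algHom (continuous_schurHom _) hs (fun k => hd k.1)
        (fun k => hd k.2)
  -- Each component of the metric is a fixed real-linear functional of the operator `c(L_ρ, R_ρ)`.
  set τ : NormedEnd (Matrix (Fin n) (Fin n) ℂ) →ₗ[ℝ] ℝ :=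
    { toFun := fun T => (Matrix.trace ((tangentBasis n i : Matrix (Fin n) (Fin n) ℂ)
        * T (tangentBasis n j))).re
      map_add' := fun S T => by simp [Matrix.mul_add]
      map_smul' := fun r T => by simp } with hτ
  have hτ1 : ContDiff ℝ ∞ τ := (LinearMap.toContinuousLinearMap τ).contDiff
  refine (hτ1.comp_contDiffOn hC1).congr fun q hq => ?_
  have hq' := isHermitian_affineChart hρ q.2
  have hd := abs_one_sub_mul_eigenvalues_lt hq' hq.2.1
  have h : C q = schurHom hq'.eigenvectorUnitary
      (fun k => chentsovMorozova (fWYD q.1) (hq'.eigenvalues k.1) (hq'.eigenvalues k.2)) := by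
    rw [hC]
    dsimp only
    rw [leftMul_eq_schurHom hq', rightMul_eq_schurHom hq']
    exact wydFunction_algHom (continuous_schurHom _) hs (fun k => hd k.1) (fun k => hd k.2) hq.1
  rw [Function.comp_apply, h, metricInChart, Matrix.of_apply, metric, dif_pos hq',
    functionOfLR_eq_schurHom]
  rfl

/-- At a fixed density matrix the scalar curvature of the WYD(`p`) metric is continuous in `p`. -/
theorem continuousAt_scal_fWYD {ρ : Matrix (Fin n) (Fin n) ℂ} (hρ : ρ.PosDef) {p : ℝ}
    (hp : 0 < p) : ContinuousAt (fun p => scal (fWYD p) ρ) p := by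
  obtain ⟨s, hs, hmem⟩ := exists_mem_logDomain hρ
  have hopen := isOpen_logDomain s ρ
  have hdet : ∀ q ∈ logDomain s ρ, (metricInChart (fWYD q.1) ρ q.2).det ≠ 0 := fun q hq => by
    have hq' := isHermitian_affineChart hρ.isHermitian q.2
    have hd := pos_of_abs_one_sub_mul_lt hs (abs_one_sub_mul_eigenvalues_lt hq' hq.2.1)
    exact det_metricInChart_ne_zero _ ρ q.2 hq' fun i j =>
      chentsovMorozova_fWYD_pos hq.1 (hd i) (hd j)
  have h := contDiffOn_scalarCurvature (g := fun p => metricInChart (fWYD p) ρ) hopen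
    (contDiffOn_metricInChart hs hρ.isHermitian) hdet
  have h1 := (h.continuousOn.continuousAt (hopen.mem_nhds (hmem p hp)))
  exact ContinuousAt.comp (f := fun p : ℝ => (p, (0 : Fin _ → ℝ))) h1
    (continuousAt_id.prodMk continuousAt_const)

theorem fWYD_one : fWYD 1 = fBKM := by
  ext x
  simp [fWYD]

/-- At a fixed density matrix the scalar curvature of the WYD(`p`) metric tends to that of the BKM
metric as `p` decreases to `1`. -/
theorem tendsto_scal_fWYD {ρ : Matrix (Fin n) (Fin n) ℂ} (hρ : ρ.PosDef) :
    Filter.Tendsto (fun p => scal (fWYD p) ρ) (nhdsWithin 1 (Set.Ioi 1)) (nhds (scal fBKM ρ)) := by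
  rw [← fWYD_one]
  exact (continuousAt_scal_fWYD hρ one_pos).tendsto.mono_left nhdsWithin_le_nhds

end Continuity

end QuantumGeometry

end

theorem mainTheorem1 (n : ℕ) :
    QuantumGeometry.WYDConjecture n → QuantumGeometry.PetzConjecture n := by
  rintro ⟨ε, hε, h⟩ A hA B hB hA' hB' hAB
  refine le_of_tendsto_of_tendsto (QuantumGeometry.tendsto_scal_fWYD hB.1)
    (QuantumGeometry.tendsto_scal_fWYD hA.1) ?_
  filter_upwards [Ioo_mem_nhdsGT (lt_add_of_pos_right 1 hε)] with p hp
  exact h p hp A hA B hB hA' hB' hAB
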